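/- **Bosonic birthday paradox for the product circuit ensemble.** Let $M, N$ be integers with $N \ge 1$ and $M \ge 2N^2$. A configuration of $N$ photons over $M$ modes is a vector $\boldsymbol{s} = (s_1,\dots,s_M)$ of non-negative integers with $\sum_{i=1}^M s_i = N$. It is collision-free if every $s_i \in \{0,1\}$. Let $B_{M,N}$ be the set of all other (collision) configurations. Fix a collision-free input configuration $\boldsymbol{t}$. For a unitary matrix $U \in \mathrm{U}(M)$, let $\mathcal{D}_U$ be the Boson Sampling output distribution on configurations, which gives the outcome $\boldsymbol{s}$ the probability $$p_{\boldsymbol{s}}(U) = \frac{1}{\prod_{i=1}^M s_i!}\,\bigl|\mathrm{Per}(U_{\boldsymbol{s},\boldsymbol{t}})\bigr|^2,$$ where $U_{\boldsymbol{s},\boldsymbol{t}}$ is the $N\times N$ matrix obtained by taking $s_i$ copies of the $i$th row and $t_j$ copies of the $j$th column of $U$. Let $\mathcal{A}$ be any linear optical circuit architecture on $M$ modes, that is, a finite sequence of single-mode and two-mode gates with fixed types and locations and unspecified coefficients in $\mathrm{U}(1)$ or $\mathrm{U}(2)$. Let $\mathcal{H}_{\mathcal{A}}$ be the distribution of the circuit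 (the product of its gates in $\mathrm{U}(M)$) when the gates are independent and Haar distributed, let $\mathcal{P}$ be the uniform distribution over all $M\times M$ permutation matrices, and let $\mathcal{H}_{\mathcal{A}}\mathcal{P}$ be the distribution of $HP$ for independent $H\sim\mathcal{H}_{\mathcal{A}}$ and $P\sim\mathcal{P}$ (the permutation acts first on the input). Then $U \mapsto \Pr_{\boldsymbol{s}\sim\mathcal{D}_U}[\boldsymbol{s}\in B_{M,N}]$ is integrable and $$\mathbb{E}_{U\sim\mathcal{H}_{\mathcal{A}}\mathcal{P}}\Bigl[\Pr_{\boldsymbol{s}\sim\mathcal{D}_U}[\boldsymbol{s}\in B_{M,N}]\Bigr] < \frac{2N^2}{M}.$$ -/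

import Mathlib

open MeasureTheory

noncomputable section

namespace BosonSampling

/-! ## Linear optical circuits as unitary matrices -/

/-- The unitary group `U(k)`: the linear optical circuits on `k` modes. -/
abbrev U (k : ℕ) : Type := Matrix.unitaryGroup (Fin k) ℂ

instance (k : ℕ) : MeasurableSpace (U k) := borel _

instance (k : ℕ) : BorelSpace (U k) := ⟨rfl⟩

instance (k : ℕ) : SecondCountableTopology (U k) :=
  haveI : SecondCountableTopology (Matrix (Fin k) (Fin k) ℂ) :=
    inferInstanceAs (SecondCountableTopology (Fin k → Fin k → ℂ))
  TopologicalSpace.Subtype.secondCountableTopology _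

instance (k : ℕ) : CompactSpace (U k) := by
  apply isCompact_iff_compactSpace.mp
  have hK : IsCompact (Set.pi Set.univ fun _ : Fin k =>
      Set.pi Set.univ fun _ : Fin k => Metric.closedBall (0 : ℂ) 1) :=
    isCompact_univ_pi fun _ => isCompact_univ_pi fun _ => isCompact_closedBall 0 1
  refine IsCompact.of_isClosed_subset (X := Matrix (Fin k) (Fin k) ℂ) hK ?_ ?_
  · have h : ((Matrix.unitaryGroup (Fin k) ℂ : Submonoid (Matrix (Fin k) (Fin k) ℂ)) :
        Set (Matrix (Fin k) (Fin k) ℂ)) = {A | A * star A = 1} := by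
      ext A
      exact Matrix.mem_unitaryGroup_iff
    rw [h]
    exact isClosed_eq (continuous_id.mul continuous_star) continuous_const
  · intro A hA i _ j _
    simpa using entry_norm_bound_of_unitary hA i j

/-- The Haar probability measure on `U(k)`. -/
def haar (k : ℕ) : Measure (U k) :=
  Measure.haarMeasure (⊤ : TopologicalSpace.PositiveCompacts (U k))

instance (k : ℕ) : IsProbabilityMeasure (haar k) :=
  ⟨by simpa [haar] using
    Measure.haarMeasure_self (K₀ := (⊤ : TopologicalSpace.PositiveCompacts (U k)))⟩

/-! ## Circuit architectures -/

/-- The type and location of a gate among `M` modes: it is a single-mode or a two-mode gate, and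
`modes` lists the (distinct) modes on which it acts. -/
structure Gate (M : ℕ) where
  /-- the number of modes on which the gate acts -/
  arity : ℕ
  arity_eq : arity = 1 ∨ arity = 2
  /-- the modes on which the gate acts -/
  modes : Fin arity ↪ Fin M

/-- A linear optical circuit architecture on `M` modes: the sequence of its gates, in the order in
which they are applied, with coefficients left open. (Gates applied in parallel act on disjoint
modes, hence commute, and may be listed in any order.) -/
abbrev Architecture (M : ℕ) : Type := List (Gate M)

/-- The `0`-`1` matrix whose column `a` is the standard basis vector of the mode `e a`. -/
def inclusionMatrix {k M : ℕ} (e : Fin k ↪ Fin M) : Matrix (Fin M) (Fin k) ℂ :=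
  Matrix.of fun i a => if i = e a then 1 else 0

/-- The `M × M` matrix of a gate with coefficients `V` on the modes `e 0, e 1, …`: it acts as `V` on
these modes and trivially on the other ones (see the three lemmas that follow). -/
def gateMatrix {k M : ℕ} (e : Fin k ↪ Fin M) (V : Matrix (Fin k) (Fin k) ℂ) :
    Matrix (Fin M) (Fin M) ℂ :=
  1 + inclusionMatrix e * (V - 1) * (inclusionMatrix e).conjTranspose

theorem gateMatrix_apply_modes {k M : ℕ} (e : Fin k ↪ Fin M) (V : Matrix (Fin k) (Fin k) ℂ)
    (a b : Fin k) : gateMatrix e V (e a) (e b) = V a b := by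
  simp [gateMatrix, inclusionMatrix, Matrix.mul_apply, Matrix.one_apply]

theorem gateMatrix_apply_left {k M : ℕ} (e : Fin k ↪ Fin M) (V : Matrix (Fin k) (Fin k) ℂ)
    (i j : Fin M) (hi : ∀ a, i ≠ e a) : gateMatrix e V i j = if i = j then 1 else 0 := by
  simp [gateMatrix, inclusionMatrix, Matrix.mul_apply, Matrix.one_apply, hi]

theorem gateMatrix_apply_right {k M : ℕ} (e : Fin k ↪ Fin M) (V : Matrix (Fin k) (Fin k) ℂ)
    (i j : Fin M) (hj : ∀ a, j ≠ e a) : gateMatrix e V i j = if i = j then 1 else 0 := by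
  simp [gateMatrix, inclusionMatrix, Matrix.mul_apply, Matrix.one_apply, hj]

theorem inclusionMatrix_isometry {k M : ℕ} (e : Fin k ↪ Fin M) :
    (inclusionMatrix e).conjTranspose * inclusionMatrix e = 1 := by
  ext a b
  simp [inclusionMatrix, Matrix.mul_apply, Matrix.one_apply, eq_comm]

theorem gateMatrix_mem {k M : ℕ} (e : Fin k ↪ Fin M) (V : U k) :
    gateMatrix e (V : Matrix (Fin k) (Fin k) ℂ) ∈ Matrix.unitaryGroup (Fin M) ℂ := by
  rw [Matrix.mem_unitaryGroup_iff]
  have hV : (V : Matrix (Fin k) (Fin k) ℂ) * (V : Matrix (Fin k) (Fin k) ℂ).conjTranspose = 1 :=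
    Matrix.mem_unitaryGroup_iff.mp V.2
  have hE := inclusionMatrix_isometry e
  generalize (V : Matrix (Fin k) (Fin k) ℂ) = W at hV
  simp only [gateMatrix, Matrix.star_eq_conjTranspose]
  generalize inclusionMatrix e = E at hE
  have h1 : (1 + E * (W - 1) * E.conjTranspose).conjTranspose
      = 1 + E * (W.conjTranspose - 1) * E.conjTranspose := by
    simp [Matrix.conjTranspose_mul, Matrix.mul_assoc]
  rw [h1]
  have h2 : (E * (W - 1) * E.conjTranspose) * (E * (W.conjTranspose - 1) * E.conjTranspose)
      = E * ((W - 1) * (W.conjTranspose - 1)) * E.conjTranspose := by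
    calc _ = E * (W - 1) * (E.conjTranspose * E) * (W.conjTranspose - 1) * E.conjTranspose := by
          simp only [Matrix.mul_assoc]
      _ = _ := by rw [hE]; simp only [Matrix.mul_assoc, Matrix.one_mul]
  have h3 : (W - 1) * (W.conjTranspose - 1) = -(W - 1) - (W.conjTranspose - 1) := by
    rw [sub_mul, mul_sub, hV]; simp only [Matrix.mul_one, Matrix.one_mul]; abel
  rw [add_mul, mul_add, mul_add, h2, h3]
  simp only [Matrix.mul_sub, Matrix.sub_mul, Matrix.mul_one, Matrix.one_mul, Matrix.mul_neg,
    Matrix.neg_mul]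
  abel

/-- The `M`-mode circuit that consists of one gate with coefficients `V`. -/
def gateUnitary {k M : ℕ} (e : Fin k ↪ Fin M) (V : U k) : U M :=
  ⟨gateMatrix e V, gateMatrix_mem e V⟩

/-- A choice of the coefficients of all gates of an architecture. -/
abbrev Coefficients {M : ℕ} (A : Architecture M) : Type :=
  (g : Fin A.length) → U (A.get g).arity

/-- The circuit with architecture `A` and gate coefficients `V`: the product of its gates, where
gates that are applied earlier stand further to the right. -/
def circuit {M : ℕ} (A : Architecture M) (V : Coefficients A) : U M :=
  ((List.ofFn fun g => gateUnitary (A.get g).modes (V g)).reverse).prod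

/-! ## Random circuits -/

/-- The local random circuit ensemble over the architecture `A`: the law of the circuit whose gate
coefficients are independent and Haar distributed. -/
def localRandomEnsemble {M : ℕ} (A : Architecture M) : Measure (U M) :=
  Measure.map (circuit A) (Measure.pi fun g : Fin A.length => haar (A.get g).arity)

theorem permMatrix_mem {M : ℕ} (σ : Equiv.Perm (Fin M)) :
    σ.permMatrix ℂ ∈ Matrix.unitaryGroup (Fin M) ℂ := by
  rw [Matrix.mem_unitaryGroup_iff, Matrix.star_eq_conjTranspose, Matrix.conjTranspose_permMatrix,
    ← Matrix.permMatrix_mul]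
  simp

/-- The permutation circuit of `σ`. -/
def permUnitary {M : ℕ} (σ : Equiv.Perm (Fin M)) : U M :=
  ⟨σ.permMatrix ℂ, permMatrix_mem σ⟩

/-- The random permutation circuit ensemble: the law of a uniformly random `M × M` permutation
matrix. -/
def permutationEnsemble (M : ℕ) : Measure (U M) :=
  ((PMF.uniformOfFintype (Equiv.Perm (Fin M))).map permUnitary).toMeasure

/-- The product circuit ensemble: the law of `H * P` for independent `H` and `P`, drawn from the
local random circuit ensemble over `A` and the random permutation circuit ensemble. The permutation
circuit acts first on the input. -/
def productEnsemble {M : ℕ} (A : Architecture M) : Measure (U M) :=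
  Measure.map (fun x : U M × U M => x.1 * x.2)
    ((localRandomEnsemble A).prod (permutationEnsemble M))

theorem continuous_circuit {M : ℕ} (A : Architecture M) : Continuous (circuit A) := by
  have hg : ∀ g : Fin A.length,
      Continuous fun V : Coefficients A => gateUnitary (A.get g).modes (V g) := by
    intro g
    refine Continuous.subtype_mk ?_ _
    have hv : Continuous fun V : Coefficients A =>
        ((V g : U (A.get g).arity) : Matrix (Fin (A.get g).arity) (Fin (A.get g).arity) ℂ) :=
      continuous_subtype_val.comp (continuous_apply g)
    unfold gateMatrix
    exact continuous_const.add
      ((continuous_const.matrix_mul (hv.sub continuous_const)).matrix_mul continuous_const)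
  have h : (circuit A) = fun V : Coefficients A =>
      (((List.finRange A.length).reverse).map fun g =>
        gateUnitary (A.get g).modes (V g)).prod := by
    funext V
    rw [circuit, List.ofFn_eq_map, List.map_reverse]
  rw [h]
  exact continuous_list_prod _ fun g _ => hg g

instance {M : ℕ} (A : Architecture M) : IsProbabilityMeasure (localRandomEnsemble A) :=
  Measure.isProbabilityMeasure_map (continuous_circuit A).measurable.aemeasurable

instance (M : ℕ) : IsProbabilityMeasure (permutationEnsemble M) :=
  PMF.toMeasure.isProbabilityMeasure _

instance {M : ℕ} (A : Architecture M) : IsProbabilityMeasure (productEnsemble A) :=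
  Measure.isProbabilityMeasure_map
    (continuous_fst.mul continuous_snd).measurable.aemeasurable

/-! ## Output probabilities -/

/-- The configurations of `N` photons over `M` modes: `s i` is the number of photons in the
mode `i`. -/
abbrev Configuration (M N : ℕ) : Type := {s : Fin M → ℕ // ∑ i, s i = N}

instance (M N : ℕ) : Fintype (Configuration M N) :=
  Fintype.subtype (Finset.Nat.antidiagonalTuple M N) fun _ => Finset.Nat.mem_antidiagonalTuple

/-- No mode holds more than one photon. -/
def CollisionFree {M N : ℕ} (s : Configuration M N) : Prop := ∀ i, s.1 i ≤ 1

/-- The set of collision configurations. -/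
def collisionOutcomes (M N : ℕ) : Set (Configuration M N) := {s | ¬ CollisionFree s}

/-- The modes of the `N` photons of `s`, in increasing order: the mode `i` occurs `s i` times. -/
def photonMode {M N : ℕ} (s : Configuration M N) (k : Fin N) : Fin M :=
  (finSigmaFinEquiv.symm (Fin.cast s.2.symm k)).1

/-- The `N × N` matrix that consists of `s i` copies of the row `i` and `t j` copies of the
column `j` of `C`. -/
def photonMatrix {M N : ℕ} (C : U M) (s t : Configuration M N) : Matrix (Fin N) (Fin N) ℂ :=
  (C : Matrix (Fin M) (Fin M) ℂ).submatrix (photonMode s) (photonMode t)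

/-- The output probability of the outcome `s` for the circuit `C` and the collision-free input
configuration `t`. -/
def outputProbability {M N : ℕ} (t : Configuration M N) (C : U M) (s : Configuration M N) : ℝ :=
  1 / (∏ i, (s.1 i).factorial : ℝ) * ‖(photonMatrix C s t).permanent‖ ^ 2

open Classical in
/-- The probability that the outcome lies in `S`, under the output distribution of the circuit `C`
with the input configuration `t`. -/
def outcomeProbability {M N : ℕ} (t : Configuration M N) (C : U M)
    (S : Set (Configuration M N)) : ℝ :=
  ∑ s with s ∈ S, outputProbability t C s

end BosonSampling

end

/-!
Label the photons, so that a circuit with a given input sends them to a random sequence of output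
modes. A collision occurs when some pair of photons shares a mode, and the union bound over pairs of
photons applies. Expand the probability that a given pair ends up in the mode `i` as a sum over two
permutations of the photons: by unitarity, each first permutation leaves only two second ones, which
contribute equally. Summed over unordered pairs, this bounds the collision probability of `C` by
`∑ i, ∑ a ≠ b, |C i (t a)|² |C i (t b)|²`, where `t a` is the input mode of the photon `a`. A random
permutation in front of `C` replaces `t a ≠ t b` by two random distinct columns. The numbers
`|C i j|²` in a row have mean `1 / M`, and sampling without replacement is negatively correlated, so
each of the `M N (N - 1)` terms averages to at most `1 / M²`. The total is at most `N (N - 1) / M`,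
whatever the law of `C`.
-/

namespace BosonSampling

open Finset Matrix
open scoped Nat

section RandomPermutations

variable {α : Type*} [Fintype α]

theorem sum_offDiag_map_perm {R : Type*} [AddCommMonoid R] (σ : Equiv.Perm α) (F : α → α → R) :
    ∑ p ∈ (univ : Finset α).offDiag, F (σ p.1) (σ p.2) =
      ∑ p ∈ (univ : Finset α).offDiag, F p.1 p.2 :=
  sum_equiv (σ.prodCongr σ) (by simp) (by simp)

theorem sum_perm_apply_eq_of_ne [DecidableEq α] {R : Type*} [AddCommMonoid R] {x y x' y' : α}
    (h : x ≠ y) (h' : x' ≠ y') (F : α → α → R) :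
    ∑ σ : Equiv.Perm α, F (σ x') (σ y') = ∑ σ : Equiv.Perm α, F (σ x) (σ y) := by
  obtain ⟨τ, rfl, rfl⟩ := MulAction.is_two_pretransitive_iff.mp
    (Equiv.Perm.isMultiplyPretransitive α 2) h h'
  exact Equiv.sum_comp (Equiv.mulRight τ) fun σ : Equiv.Perm α => F (σ x) (σ y)

theorem card_offDiag_nsmul_sum_perm [DecidableEq α] {R : Type*} [AddCommMonoid R] {x y : α}
    (h : x ≠ y) (F : α → α → R) :
    #(univ : Finset α).offDiag • ∑ σ : Equiv.Perm α, F (σ x) (σ y) =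
      (Fintype.card α)! • ∑ p ∈ (univ : Finset α).offDiag, F p.1 p.2 := by
  calc
    _ = ∑ p ∈ (univ : Finset α).offDiag, ∑ σ : Equiv.Perm α, F (σ p.1) (σ p.2) := by
      rw [← sum_const]
      exact sum_congr rfl fun p hp => sum_perm_apply_eq_of_ne (mem_offDiag.mp hp).2.2 h F
    _ = ∑ _ : Equiv.Perm α, ∑ p ∈ (univ : Finset α).offDiag, F p.1 p.2 := by
      rw [sum_comm]
      exact sum_congr rfl fun σ _ => sum_offDiag_map_perm σ F
    _ = _ := by rw [sum_const, card_univ, Fintype.card_perm]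

theorem card_mul_sum_offDiag_mul_le (g : α → ℝ) :
    Fintype.card α * ∑ p ∈ (univ : Finset α).offDiag, g p.1 * g p.2 ≤
      (Fintype.card α - 1) * (∑ x, g x) ^ 2 := by
  classical
  have hsplit : ∑ x, g x ^ 2 + ∑ p ∈ (univ : Finset α).offDiag, g p.1 * g p.2 =
      (∑ x, g x) ^ 2 := by
    rw [sq, sum_mul_sum, ← sum_product', ← diag_union_offDiag,
      sum_union (disjoint_diag_offDiag _), sum_diag]
    simp only [sq]
  have hcs := sq_sum_le_card_mul_sum_sq (s := univ) (f := g)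
  rw [card_univ] at hcs
  linarith [congrArg ((Fintype.card α : ℝ) * ·) hsplit]

-- Sampling without replacement: the values of `g` at two distinct points of a random permutation
-- are negatively correlated.
theorem card_sq_mul_sum_perm_mul_le [DecidableEq α] {x y : α} (h : x ≠ y) (g : α → ℝ) :
    (Fintype.card α : ℝ) ^ 2 * ∑ σ : Equiv.Perm α, g (σ x) * g (σ y) ≤
      (Fintype.card α)! * (∑ x, g x) ^ 2 := by
  have hcard : (1 : ℝ) < Fintype.card α := by
    exact_mod_cast Fintype.one_lt_card_iff.mpr ⟨x, y, h⟩
  have hpairs : (Fintype.card α * (Fintype.card α - 1) : ℝ) *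
      ∑ σ : Equiv.Perm α, g (σ x) * g (σ y) =
        (Fintype.card α)! * ∑ p ∈ (univ : Finset α).offDiag, g p.1 * g p.2 := by
    simpa [offDiag_card, nsmul_eq_mul, Nat.cast_sub (Nat.le_mul_self _), mul_sub] using
      card_offDiag_nsmul_sum_perm h fun x y => g x * g y
  refine le_of_mul_le_mul_left ?_ (sub_pos.mpr hcard)
  calc
    _ = (Fintype.card α)! *
        (Fintype.card α * ∑ p ∈ (univ : Finset α).offDiag, g p.1 * g p.2) := by
      linear_combination (Fintype.card α : ℝ) * hpairs
    _ ≤ (Fintype.card α)! * ((Fintype.card α - 1) * (∑ x, g x) ^ 2) := by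
      exact mul_le_mul_of_nonneg_left (card_mul_sum_offDiag_mul_le g) (by positivity)
    _ = _ := by ring

end RandomPermutations

section Fibers

variable {ι α : Type*} [Fintype ι] [DecidableEq α]

theorem exists_perm_comp_eq {m f : ι → α}
    (h : ∀ i, Fintype.card {k // f k = i} = Fintype.card {k // m k = i}) :
    ∃ σ : Equiv.Perm ι, m ∘ σ = f :=
  ⟨Equiv.ofFiberEquiv fun i => Fintype.equivOfCardEq (h i),
    funext fun k => Equiv.ofFiberEquiv_map _ k⟩

theorem card_perm_comp_eq [DecidableEq ι] [Fintype α] {m f : ι → α}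
    (h : ∀ i, Fintype.card {k // f k = i} = Fintype.card {k // m k = i}) :
    #{σ : Equiv.Perm ι | m ∘ σ = f} = ∏ i, (Fintype.card {k // m k = i})! := by
  obtain ⟨τ, rfl⟩ := exists_perm_comp_eq h
  rw [← DomMulAct.stabilizer_card m, Fintype.card_subtype]
  refine card_equiv (Equiv.mulRight τ⁻¹) fun σ => ?_
  simp only [mem_filter, mem_univ, true_and, Equiv.coe_mulRight, Equiv.Perm.coe_mul,
    ← Function.comp_assoc]
  exact (Equiv.comp_symm_eq τ m (m ∘ σ)).symm

theorem card_fiber_comp_perm (m : ι → α) (σ : Equiv.Perm ι) (i : α) :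
    Fintype.card {k // (m ∘ σ) k = i} = Fintype.card {k // m k = i} :=
  Fintype.card_congr (σ.subtypeEquiv fun _ => Iff.rfl)

theorem sum_perm_comp [DecidableEq ι] [Fintype α] {R : Type*} [AddCommMonoid R] (m : ι → α)
    (G : (ι → α) → R) :
    ∑ σ : Equiv.Perm ι, G (m ∘ σ) =
      (∏ i, (Fintype.card {k // m k = i})!) •
        ∑ f with ∀ i, Fintype.card {k // f k = i} = Fintype.card {k // m k = i}, G f := by
  rw [smul_sum, ← sum_fiberwise_of_maps_to' (g := fun σ : Equiv.Perm ι => m ∘ σ)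
    (t := {f | ∀ i, Fintype.card {k // f k = i} = Fintype.card {k // m k = i}})
    fun σ _ => mem_filter.mpr ⟨mem_univ _, card_fiber_comp_perm m σ⟩]
  refine sum_congr rfl fun f hf => ?_
  rw [sum_const, card_perm_comp_eq (mem_filter.mp hf).2]

theorem two_le_card_filter_offDiag {f : ι → α} (hf : ¬ Function.Injective f) :
    2 ≤ #{p ∈ (univ : Finset ι).offDiag | f p.1 = f p.2} := by
  obtain ⟨a, b, hfab, hab⟩ := Function.not_injective_iff.mp hf
  refine one_lt_card.mpr ⟨(a, b), ?_, (b, a), ?_, ?_⟩ <;> grind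

theorem two_mul_sum_not_injective_le [DecidableEq ι] [Fintype α] {w : (ι → α) → ℝ}
    (hw : ∀ f, 0 ≤ w f) :
    2 * ∑ f with ¬ Function.Injective f, w f ≤
      ∑ p ∈ (univ : Finset ι).offDiag, ∑ i, ∑ f with f p.1 = i ∧ f p.2 = i, w f := by
  calc
    _ ≤ ∑ f, #{p ∈ (univ : Finset ι).offDiag | f p.1 = f p.2} * w f := by
      rw [mul_sum]
      refine (sum_le_sum fun f hf => ?_).trans
        (sum_le_sum_of_subset_of_nonneg (filter_subset _ _) fun f _ _ => ?_)
      · gcongr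
        · exact hw f
        · exact_mod_cast two_le_card_filter_offDiag (mem_filter.mp hf).2
      · exact mul_nonneg (Nat.cast_nonneg _) (hw f)
    _ = ∑ p ∈ (univ : Finset ι).offDiag, ∑ f with f p.1 = f p.2, w f := by
      simp only [← nsmul_eq_mul, ← sum_const, sum_filter]
      exact sum_comm
    _ = _ := by
      refine sum_congr rfl fun p _ => ?_
      rw [← sum_fiberwise _ (fun f : ι → α => f p.1)]
      refine sum_congr rfl fun i _ => ?_
      rw [filter_filter]
      refine sum_congr (filter_congr fun f _ => ?_) fun _ _ => rfl
      grind

end Fibers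

section Permanents

variable {ι n : Type*} [Fintype ι] [DecidableEq ι]

theorem permanent_submatrix_rows {R : Type*} [CommSemiring R] (A : Matrix n ι R) (f : ι → n) :
    (A.submatrix f id).permanent = ∑ σ : Equiv.Perm ι, ∏ k, A (f k) (σ k) := by
  rw [← permanent_transpose]
  rfl

theorem sum_piFinset_norm_sq_permanent (A : Matrix n ι ℂ) (T : ι → Finset n) :
    ((∑ f ∈ Fintype.piFinset T, ‖(A.submatrix f id).permanent‖ ^ 2 : ℝ) : ℂ) =
      ∑ σ : Equiv.Perm ι, ∑ τ : Equiv.Perm ι,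
        ∏ k, ∑ j ∈ T k, A j (σ k) * star (A j (τ k)) := by
  push_cast
  calc
    _ = ∑ f ∈ Fintype.piFinset T, ∑ σ : Equiv.Perm ι, ∑ τ : Equiv.Perm ι,
        ∏ k, A (f k) (σ k) * star (A (f k) (τ k)) := by
      refine sum_congr rfl fun f _ => ?_
      rw [← Complex.mul_conj', permanent_submatrix_rows, map_sum, sum_mul_sum]
      simp only [map_prod, ← prod_mul_distrib, Complex.star_def]
    _ = ∑ σ : Equiv.Perm ι, ∑ τ : Equiv.Perm ι, ∑ f ∈ Fintype.piFinset T,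
        ∏ k, A (f k) (σ k) * star (A (f k) (τ k)) := by
      rw [sum_comm]
      exact sum_congr rfl fun _ _ => sum_comm
    _ = _ := by simp only [prod_univ_sum]

theorem eq_or_eq_mul_swap {α : Type*} [DecidableEq α] {σ τ : Equiv.Perm α} {a b : α}
    (h : ∀ k, k ≠ a → k ≠ b → τ k = σ k) : τ = σ ∨ τ = σ * Equiv.swap a b := by
  have mem_pair {x : α} (hx : x = a ∨ x = b) : τ x = σ a ∨ τ x = σ b := by
    obtain ⟨c, hc⟩ := σ.surjective (τ x)
    rcases eq_or_ne c a with rfl | hca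
    · exact .inl hc.symm
    rcases eq_or_ne c b with rfl | hcb
    · exact .inr hc.symm
    have := τ.injective ((h c hca hcb).trans hc)
    grind
  have ha := mem_pair (.inl rfl)
  have hb := mem_pair (.inr rfl)
  have hinj : τ a = τ b → a = b := fun h => τ.injective h
  by_cases haa : τ a = σ a
  · exact .inl (Equiv.ext fun k => by by_cases hk : k = a <;> grind)
  · exact .inr (Equiv.ext fun k => by
      rw [Equiv.Perm.mul_apply, Equiv.swap_apply_def]
      grind)

variable [Fintype n] {A : Matrix n ι ℂ}

theorem prod_sum_mul_star_of_isometry (hA : Aᴴ * A = 1) {a b : ι} (hab : a ≠ b) (i : n)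
    (σ τ : Equiv.Perm ι) :
    ∏ k, ∑ j ∈ if k = a ∨ k = b then {i} else univ, A j (σ k) * star (A j (τ k)) =
      if ∀ k, k ≠ a → k ≠ b → τ k = σ k then
        A i (σ a) * star (A i (τ a)) * (A i (σ b) * star (A i (τ b)))
      else 0 := by
  have horth (k : ι) : ∑ j, A j (σ k) * star (A j (τ k)) = if τ k = σ k then 1 else 0 := by
    simpa only [mul_apply, conjTranspose_apply, one_apply, mul_comm] using
      congrFun (congrFun hA (τ k)) (σ k)
  split_ifs with h
  · rw [Fintype.prod_eq_mul a b hab fun k hk => by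
      rw [if_neg (not_or.mpr hk), horth, if_pos (h k hk.1 hk.2)]]
    simp only [true_or, or_true, if_true, sum_singleton]
  · push Not at h
    obtain ⟨k, hka, hkb, hk⟩ := h
    refine prod_eq_zero (mem_univ k) ?_
    rw [if_neg (not_or.mpr ⟨hka, hkb⟩), horth, if_neg hk]

/- Bosonic bunching: besides `τ = σ`, the exchange `τ = σ * swap a b` survives and contributes the
same amount, whence the factor `2`. -/
theorem sum_norm_sq_permanent_of_apply_eq [DecidableEq n] (hA : Aᴴ * A = 1) {a b : ι}
    (hab : a ≠ b) (i : n) :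
    ∑ f : ι → n with f a = i ∧ f b = i, ‖(A.submatrix f id).permanent‖ ^ 2 =
      2 * ∑ σ : Equiv.Perm ι, ‖A i (σ a)‖ ^ 2 * ‖A i (σ b)‖ ^ 2 := by
  have hbox : ({f : ι → n | f a = i ∧ f b = i} : Finset (ι → n)) =
      Fintype.piFinset fun k => if k = a ∨ k = b then {i} else univ := by
    ext f
    simp only [mem_filter, mem_univ, true_and, Fintype.mem_piFinset]
    grind
  apply Complex.ofReal_injective
  rw [hbox, sum_piFinset_norm_sq_permanent]
  push_cast
  rw [mul_sum]
  refine sum_congr rfl fun σ _ => ?_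
  have hne : σ ≠ σ * Equiv.swap a b := by
    simpa [Equiv.swap_eq_one_iff] using hab
  have hoff (k : ι) (hka : k ≠ a) (hkb : k ≠ b) : (σ * Equiv.swap a b) k = σ k := by
    rw [Equiv.Perm.mul_apply, Equiv.swap_apply_of_ne_of_ne hka hkb]
  simp only [prod_sum_mul_star_of_isometry hA hab]
  rw [Fintype.sum_eq_add σ (σ * Equiv.swap a b) hne fun τ hτ =>
      if_neg fun h => (eq_or_eq_mul_swap h).elim hτ.1 hτ.2,
    if_pos fun _ _ _ => rfl, if_pos hoff]
  simp only [Equiv.Perm.mul_apply, Equiv.swap_apply_left, Equiv.swap_apply_right,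
    ← Complex.mul_conj', Complex.star_def]
  ring

theorem sum_norm_sq_permanent_not_injective_le [DecidableEq n] (hA : Aᴴ * A = 1) :
    ∑ f : ι → n with ¬ Function.Injective f, ‖(A.submatrix f id).permanent‖ ^ 2 ≤
      (Fintype.card ι)! *
        ∑ i, ∑ p ∈ (univ : Finset ι).offDiag, ‖A i p.1‖ ^ 2 * ‖A i p.2‖ ^ 2 := by
  refine le_of_mul_le_mul_left ?_ (zero_lt_two' ℝ)
  calc
    _ ≤ ∑ p ∈ (univ : Finset ι).offDiag, ∑ i, ∑ f : ι → n with f p.1 = i ∧ f p.2 = i,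
        ‖(A.submatrix f id).permanent‖ ^ 2 :=
      two_mul_sum_not_injective_le fun _ => sq_nonneg _
    _ = ∑ p ∈ (univ : Finset ι).offDiag, ∑ i, 2 * ∑ σ : Equiv.Perm ι,
        ‖A i (σ p.1)‖ ^ 2 * ‖A i (σ p.2)‖ ^ 2 :=
      sum_congr rfl fun p hp => sum_congr rfl fun i _ =>
        sum_norm_sq_permanent_of_apply_eq hA (mem_offDiag.mp hp).2.2 i
    _ = 2 * ∑ i, ∑ σ : Equiv.Perm ι, ∑ p ∈ (univ : Finset ι).offDiag,
        ‖A i (σ p.1)‖ ^ 2 * ‖A i (σ p.2)‖ ^ 2 := by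
      simp only [← mul_sum]
      rw [sum_comm]
      exact congrArg _ (sum_congr rfl fun _ _ => sum_comm)
    _ = _ := by
      rw [mul_sum univ _ ((Fintype.card ι)! : ℝ)]
      refine congrArg _ (sum_congr rfl fun i _ => ?_)
      rw [sum_congr rfl fun σ _ => sum_offDiag_map_perm σ fun x y => ‖A i x‖ ^ 2 * ‖A i y‖ ^ 2,
        sum_const, card_univ, Fintype.card_perm, nsmul_eq_mul]

end Permanents

section OutputDistribution

variable {M N : ℕ}

/-- The occupation numbers of a sequence `f` of `N` modes, one for each photon. They relate the
second-quantized description by configurations to the first-quantized one, in which the photons are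
labelled. -/
def occupation (f : Fin N → Fin M) : Configuration M N :=
  ⟨fun i => Fintype.card {k // f k = i}, by
    rw [← Fintype.card_sigma, Fintype.card_congr (Equiv.sigmaFiberEquiv f), Fintype.card_fin]⟩

theorem occupation_photonMode (s : Configuration M N) : occupation (photonMode s) = s := by
  let e : Fin N ≃ (i : Fin M) × Fin (s.1 i) := (finCongr s.2.symm).trans finSigmaFinEquiv.symm
  refine Subtype.ext (funext fun i => ?_)
  have hfiber : {k // photonMode s k = i} ≃ {x : (i : Fin M) × Fin (s.1 i) // x.1 = i} :=
    e.subtypeEquiv fun _ => Iff.rfl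
  exact (Fintype.card_congr (hfiber.trans (Equiv.sigmaSubtype i))).trans (Fintype.card_fin _)

theorem collisionFree_occupation_iff {f : Fin N → Fin M} :
    CollisionFree (occupation f) ↔ Function.Injective f := by
  simp only [CollisionFree, occupation, Fintype.card_le_one_iff_subsingleton]
  exact ⟨fun h a b hab => congrArg Subtype.val ((h (f b)).elim ⟨a, hab⟩ ⟨b, rfl⟩),
    fun h i => ⟨fun a b => Subtype.ext (h (a.2.trans b.2.symm))⟩⟩

theorem photonMode_injective {t : Configuration M N} (ht : CollisionFree t) :
    Function.Injective (photonMode t) := by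
  rwa [← collisionFree_occupation_iff, occupation_photonMode]

theorem outputProbability_eq_sum_occupation_eq (t : Configuration M N) (C : U M)
    (s : Configuration M N) :
    outputProbability t C s = (N ! : ℝ)⁻¹ * ∑ f with occupation f = s,
      ‖((C.1.submatrix id (photonMode t)).submatrix f id).permanent‖ ^ 2 := by
  have hcard (i : Fin M) : Fintype.card {k // photonMode s k = i} = s.1 i :=
    congrFun (congrArg Subtype.val (occupation_photonMode s)) i
  have hfiber (f : Fin N → Fin M) :
      (∀ i, Fintype.card {k // f k = i} = s.1 i) ↔ occupation f = s :=
    ⟨fun h => Subtype.ext (funext h), fun h i => congrFun (congrArg Subtype.val h) i⟩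
  have hperm := sum_perm_comp (photonMode s) fun f =>
    ‖((C.1.submatrix id (photonMode t)).submatrix f id).permanent‖ ^ 2
  have hinv (σ : Equiv.Perm (Fin N)) :
      ((C.1.submatrix id (photonMode t)).submatrix (photonMode s ∘ σ) id).permanent =
        (photonMatrix C s t).permanent :=
    permanent_permute_cols σ (photonMatrix C s t)
  simp only [hinv, hcard, hfiber, sum_const, card_univ, Fintype.card_perm, Fintype.card_fin,
    nsmul_eq_mul, Nat.cast_prod] at hperm
  have hs : ∏ i, ((s.1 i)! : ℝ) ≠ 0 := prod_ne_zero_iff.mpr fun i _ => by positivity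
  rw [outputProbability]
  field_simp
  rw [mul_comm]
  exact hperm

theorem outcomeProbability_collisionOutcomes_eq (t : Configuration M N) (C : U M) :
    outcomeProbability t C (collisionOutcomes M N) = (N ! : ℝ)⁻¹ *
      ∑ f : Fin N → Fin M with ¬ Function.Injective f,
        ‖((C.1.submatrix id (photonMode t)).submatrix f id).permanent‖ ^ 2 := by
  classical
  simp only [outcomeProbability, outputProbability_eq_sum_occupation_eq, ← mul_sum]
  rw [sum_fiberwise_eq_sum_filter]
  refine congrArg _ (sum_congr (filter_congr fun f _ => ?_) fun _ _ => rfl)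
  exact (mem_filter_univ _).trans collisionFree_occupation_iff.not

theorem isometry_submatrix_of_injective (C : U M) {m : Fin N → Fin M}
    (hm : Function.Injective m) : (C.1.submatrix id m)ᴴ * C.1.submatrix id m = 1 := by
  rw [conjTranspose_submatrix, ← submatrix_mul _ _ m id m Function.bijective_id,
    ← star_eq_conjTranspose, mem_unitaryGroup_iff'.mp C.2, submatrix_one m hm]

theorem outcomeProbability_collisionOutcomes_le {t : Configuration M N} (ht : CollisionFree t)
    (C : U M) :
    outcomeProbability t C (collisionOutcomes M N) ≤ ∑ i, ∑ p ∈ (univ : Finset (Fin N)).offDiag,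
      ‖C.1 i (photonMode t p.1)‖ ^ 2 * ‖C.1 i (photonMode t p.2)‖ ^ 2 := by
  rw [outcomeProbability_collisionOutcomes_eq, inv_mul_le_iff₀ (by positivity)]
  simpa only [Fintype.card_fin, submatrix_apply, id_eq] using sum_norm_sq_permanent_not_injective_le
    (isometry_submatrix_of_injective C (photonMode_injective ht))

theorem sum_norm_sq_row (C : U M) (i : Fin M) : ∑ j, ‖C.1 i j‖ ^ 2 = 1 := by
  have h := congrFun (congrFun (mem_unitaryGroup_iff.mp C.2) i) i
  simp only [mul_apply, star_apply, one_apply_eq, Complex.star_def, Complex.mul_conj'] at h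
  exact_mod_cast h

theorem mul_permUnitary_apply (C : U M) (σ : Equiv.Perm (Fin M)) (i j : Fin M) :
    (C * permUnitary σ).1 i j = C.1 i (σ⁻¹ j) := by
  change (C.1 * σ.permMatrix ℂ) i j = _
  rw [Equiv.Perm.permMatrix, PEquiv.mul_toMatrix_toPEquiv]
  rfl

theorem sq_mul_sum_perm_norm_sq_mul_le (C : U M) (i : Fin M) {x y : Fin M} (hxy : x ≠ y) :
    (M : ℝ) ^ 2 * ∑ σ : Equiv.Perm (Fin M),
      ‖(C * permUnitary σ).1 i x‖ ^ 2 * ‖(C * permUnitary σ).1 i y‖ ^ 2 ≤ M ! := by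
  have hcorr := card_sq_mul_sum_perm_mul_le hxy fun j => ‖C.1 i j‖ ^ 2
  have hinv := Equiv.sum_comp (Equiv.inv (Equiv.Perm (Fin M)))
    fun σ => ‖C.1 i (σ x)‖ ^ 2 * ‖C.1 i (σ y)‖ ^ 2
  simp only [Equiv.inv_apply] at hinv
  rw [sum_norm_sq_row, Fintype.card_fin, one_pow, mul_one] at hcorr
  simp only [mul_permUnitary_apply]
  rwa [hinv]

theorem mul_sum_perm_outcomeProbability_collisionOutcomes_le {t : Configuration M N}
    (ht : CollisionFree t) (hM : 0 < M) (C : U M) :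
    M * ∑ σ : Equiv.Perm (Fin M),
      outcomeProbability t (C * permUnitary σ) (collisionOutcomes M N) ≤ M ! * (N * (N - 1)) := by
  have hpairs : (#(univ : Finset (Fin N)).offDiag : ℝ) = N * (N - 1) := by
    rw [offDiag_card, card_univ, Fintype.card_fin, Nat.cast_sub (Nat.le_mul_self _)]
    push_cast
    ring
  refine le_of_mul_le_mul_left ?_ (Nat.cast_pos (α := ℝ).mpr hM)
  calc
    _ = (M : ℝ) ^ 2 * ∑ σ : Equiv.Perm (Fin M),
        outcomeProbability t (C * permUnitary σ) (collisionOutcomes M N) := by ring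
    _ ≤ (M : ℝ) ^ 2 * ∑ σ : Equiv.Perm (Fin M), ∑ i, ∑ p ∈ (univ : Finset (Fin N)).offDiag,
        ‖(C * permUnitary σ).1 i (photonMode t p.1)‖ ^ 2 *
          ‖(C * permUnitary σ).1 i (photonMode t p.2)‖ ^ 2 := by
      gcongr
      exact outcomeProbability_collisionOutcomes_le ht _
    _ = ∑ i, ∑ p ∈ (univ : Finset (Fin N)).offDiag, (M : ℝ) ^ 2 * ∑ σ : Equiv.Perm (Fin M),
        ‖(C * permUnitary σ).1 i (photonMode t p.1)‖ ^ 2 *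
          ‖(C * permUnitary σ).1 i (photonMode t p.2)‖ ^ 2 := by
      simp only [← mul_sum]
      rw [sum_comm]
      exact congrArg _ (sum_congr rfl fun _ _ => sum_comm)
    _ ≤ ∑ _i : Fin M, ∑ _p ∈ (univ : Finset (Fin N)).offDiag, (M ! : ℝ) :=
      sum_le_sum fun i _ => sum_le_sum fun p hp =>
        sq_mul_sum_perm_norm_sq_mul_le C i ((photonMode_injective ht).ne (mem_offDiag.mp hp).2.2)
    _ = _ := by
      simp only [sum_const, nsmul_eq_mul, card_univ, Fintype.card_fin, hpairs]
      ring

theorem continuous_outcomeProbability (t : Configuration M N) (S : Set (Configuration M N)) :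
    Continuous fun C : U M => outcomeProbability t C S := by
  unfold outcomeProbability outputProbability permanent photonMatrix
  refine continuous_finsetSum _ fun s _ => continuous_const.mul (Continuous.pow ?_ 2)
  refine Continuous.norm (continuous_finsetSum _ fun σ _ => continuous_finsetProd _ fun i _ => ?_)
  exact continuous_subtype_val.matrix_elem _ _

end OutputDistribution

section Ensembles

variable {M N : ℕ}

theorem integral_permutationEnsemble {E : Type*} [NormedAddCommGroup E] [NormedSpace ℝ E]
    [CompleteSpace E] {f : U M → E}
    (hf : AEStronglyMeasurable f (permutationEnsemble M)) :
    ∫ P, f P ∂(permutationEnsemble M) = (M ! : ℝ)⁻¹ • ∑ σ, f (permUnitary σ) := by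
  let _ : MeasurableSpace (Equiv.Perm (Fin M)) := ⊤
  have hmeas : Measurable (permUnitary (M := M)) := measurable_from_top
  have hmap : permutationEnsemble M =
      (PMF.uniformOfFintype (Equiv.Perm (Fin M))).toMeasure.map permUnitary :=
    (PMF.toMeasure_map _ _ hmeas).symm
  rw [hmap] at hf ⊢
  rw [integral_map hmeas.aemeasurable hf, PMF.integral_eq_sum, smul_sum]
  simp only [PMF.uniformOfFintype_apply, Fintype.card_perm, Fintype.card_fin, ENNReal.toReal_inv,
    ENNReal.toReal_natCast]

theorem integral_collisionOutcomes_permutationEnsemble_le {t : Configuration M N}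
    (ht : CollisionFree t) (hM : 0 < M) (C : U M) :
    ∫ P, outcomeProbability t (C * P) (collisionOutcomes M N) ∂(permutationEnsemble M) ≤
      N * (N - 1) / M := by
  have hcont : Continuous fun P => outcomeProbability t (C * P) (collisionOutcomes M N) :=
    (continuous_outcomeProbability t _).comp (continuous_const_mul C)
  rw [integral_permutationEnsemble hcont.aestronglyMeasurable, smul_eq_mul,
    inv_mul_le_iff₀ (by positivity), mul_div_assoc', le_div_iff₀' (by positivity)]
  exact mul_sum_perm_outcomeProbability_collisionOutcomes_le ht hM C

end Ensembles

end BosonSampling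

open BosonSampling in
open scoped MeasureTheory in
theorem mainTheorem7_general {M N : ℕ} (hM : 0 < M) {t : Configuration M N}
    (ht : CollisionFree t) (μ : Measure (U M)) [IsProbabilityMeasure μ] :
    Integrable (fun C => outcomeProbability t C (collisionOutcomes M N))
        (μ ∗ₘ permutationEnsemble M) ∧
      ∫ C, outcomeProbability t C (collisionOutcomes M N) ∂(μ ∗ₘ permutationEnsemble M) ≤
        N * (N - 1) / M := by
  have hint :=
    (continuous_outcomeProbability t (collisionOutcomes M N)).integrable_of_hasCompactSupport
      (μ := μ ∗ₘ permutationEnsemble M) (.of_compactSpace _)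
  have hprod := hint.comp_measurable measurable_mul
  refine ⟨hint, ?_⟩
  calc
    _ = ∫ H, ∫ P, outcomeProbability t (H * P) (collisionOutcomes M N)
          ∂(permutationEnsemble M) ∂μ :=
      integral_mconv hint
    _ ≤ ∫ _, (N * (N - 1) / M : ℝ) ∂μ :=
      integral_mono hprod.integral_prod_left (integrable_const _)
        (integral_collisionOutcomes_permutationEnsemble_le ht hM)
    _ = _ := by rw [integral_const, probReal_univ, one_smul]

theorem mainTheorem7 (M N : ℕ) (hN : 1 ≤ N) (hM : 2 * N ^ 2 ≤ M)
    (A : BosonSampling.Architecture M)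
    (t : BosonSampling.Configuration M N) (ht : BosonSampling.CollisionFree t) :
    MeasureTheory.Integrable
        (fun C : BosonSampling.U M =>
          BosonSampling.outcomeProbability t C (BosonSampling.collisionOutcomes M N))
        (BosonSampling.productEnsemble A) ∧
      (∫ C : BosonSampling.U M,
          BosonSampling.outcomeProbability t C (BosonSampling.collisionOutcomes M N)
          ∂(BosonSampling.productEnsemble A)) < 2 * (N : ℝ) ^ 2 / (M : ℝ) := by
  have hMpos : 0 < M := by nlinarith
  obtain ⟨hint, hle⟩ := mainTheorem7_general hMpos ht (BosonSampling.localRandomEnsemble A)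
  rw [show BosonSampling.productEnsemble A = (BosonSampling.localRandomEnsemble A).mconv
    (BosonSampling.permutationEnsemble M) from rfl]
  refine ⟨hint, hle.trans_lt ?_⟩
  have hNpos : (1 : ℝ) ≤ N := by exact_mod_cast hN
  exact div_lt_div_of_pos_right (by nlinarith) (Nat.cast_pos.mpr hMpos)
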